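/- Let $(S,\Sigma,P)$ be a probability space that is adequate: either $P$ is nonatomic (every $A\in\Sigma$ with $P(A)>0$ has a subset $B\in\Sigma$ with $0<P(B)<P(A)$), or $P$ is uniform on a finite partition of $S$ (its $n$ cells all have probability $1/n$) that generates $\Sigma$. Let $\mathcal F$ be either $\mathcal L^\infty$, the space of all almost surely bounded random variables $f:S\to\mathbb R$, or $\mathcal M^\infty$, the space of all random variables $f:S\to\mathbb R$ with $\mathbb E[|f|^p]<\infty$ for all $p\in\mathbb N$. Write $f\overset{d}{=}g$ when $f$ and $g$ have the same distribution under $P$, and identify real numbers with constant random variables. Let $\Pi:\mathcal F\to\mathbb R$ be a premium calculation principle, i.e., there is $\theta>0$ such that $\Pi(h+\gamma)=\Pi(h)+\theta\gamma$ for all $h\in\mathcal F$ and $\gamma\in\mathbb R$. Let $\succsim$ be a risk preference on $\mathcal F$, i.e., a transitive binary relation on $\mathcal F$ such that $f\overset{d}{=}g$ implies $f\succsim g$ and $g\succsim f$. Then the following properties are equivalent: (i) $\succsim$ is weakly risk averse: $\mathbb E[f]\succsim f$ for all $f\in\mathcal F$; (ii) $\succsim$ is propense to full insurance: for all $w,f,g\in\mathcal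 F$ with $g\overset{d}{=}f$, if $f=-w-\pi$ for some $\pi\in\mathbb R$, then $w+f\succsim w+g$; (iii) $\succsim$ is propense to full insurance at price $\Pi$: for all $w,f,g\in\mathcal F$ with $g\overset{d}{=}f$, if $f=-w-\Pi(-w)$, then $w+f\succsim w+g$. -/

import Mathlib

open MeasureTheory

namespace RiskInsurance

/-- `P` is nonatomic: every event of positive probability contains an event of strictly smaller
positive probability. -/
def Nonatomic {S : Type*} [MeasurableSpace S] (P : Measure S) : Prop :=
  ∀ A : Set S, MeasurableSet A → 0 < P A →
    ∃ B : Set S, MeasurableSet B ∧ B ⊆ A ∧ 0 < P B ∧ P B < P A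

/-- `P` is uniform on a finite partition that generates the sigma-algebra. -/
def UniformOnFinitePartition {S : Type*} [mS : MeasurableSpace S] (P : Measure S) : Prop :=
  ∃ C : Finset (Set S), Setoid.IsPartition (C : Set (Set S)) ∧
    mS = MeasurableSpace.generateFrom (C : Set (Set S)) ∧
    ∀ A ∈ C, P A = (C.card : ENNReal)⁻¹

/-- Adequate (probability) measures. -/
def Adequate {S : Type*} [MeasurableSpace S] (P : Measure S) : Prop :=
  Nonatomic P ∨ UniformOnFinitePartition P

/-- The two possible choices of the space of random payoffs. -/
inductive PayoffClass : Type
  /-- all almost surely bounded random variables -/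
  | bounded
  /-- all random variables with finite moments of all orders -/
  | allMoments

/-- The space of random payoffs, a space of genuine measurable functions `S → ℝ` (not of
almost-sure equivalence classes). -/
def payoffSpace {S : Type*} [MeasurableSpace S] (P : Measure S) :
    PayoffClass → Submodule ℝ (S → ℝ)
  | .bounded =>
    { carrier := {f | Measurable f ∧ MemLp f ⊤ P}
      add_mem' := fun hf hg => ⟨hf.1.add hg.1, hf.2.add hg.2⟩
      zero_mem' := ⟨measurable_zero, MemLp.zero⟩
      smul_mem' := fun c _ hf => ⟨hf.1.const_smul c, hf.2.const_smul c⟩ }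
  | .allMoments =>
    { carrier := {f | Measurable f ∧ ∀ p : ℕ, MemLp f (p : ENNReal) P}
      add_mem' := fun hf hg => ⟨hf.1.add hg.1, fun p => (hf.2 p).add (hg.2 p)⟩
      zero_mem' := ⟨measurable_zero, fun _ => MemLp.zero⟩
      smul_mem' := fun c _ hf => ⟨hf.1.const_smul c, fun p => (hf.2 p).const_smul c⟩ }

section

variable {S : Type*} [MeasurableSpace S] (P : Measure S) [IsProbabilityMeasure P]
  (κ : PayoffClass)

/-- The deterministic payoff `c`. -/
def sure (c : ℝ) : payoffSpace P κ :=
  ⟨fun _ => c, by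
    cases κ
    · exact ⟨measurable_const, memLp_const c⟩
    · exact ⟨measurable_const, fun _ => memLp_const c⟩⟩

variable {P κ}

/-- Equality in distribution. -/
def EqDist (f g : payoffSpace P κ) : Prop :=
  P.map (f : S → ℝ) = P.map (g : S → ℝ)

/-- The expectation of a random payoff. -/
noncomputable def expect (f : payoffSpace P κ) : ℝ :=
  ∫ s, (f : S → ℝ) s ∂P

/-- Risk preferences: transitive and law invariant binary relations; `R f g` means that `f` is
(weakly) preferred to `g`. -/
structure IsRiskPreference (R : payoffSpace P κ → payoffSpace P κ → Prop) : Prop where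
  trans : ∀ f g h, R f g → R g h → R f h
  lawInvariant : ∀ f g, EqDist f g → R f g ∧ R g f

/-- Weak risk aversion. -/
def WeaklyRiskAverse (R : payoffSpace P κ → payoffSpace P κ → Prop) : Prop :=
  ∀ f, R (sure P κ (expect f)) f

/-- `f` is a full insurance for the risk `w`. -/
def IsFullInsurance (w f : payoffSpace P κ) : Prop :=
  ∃ π : ℝ, f = -w - sure P κ π

/-- Propensity to full insurance. -/
def PropenseToFullInsurance (R : payoffSpace P κ → payoffSpace P κ → Prop) : Prop :=
  ∀ w f g : payoffSpace P κ, EqDist g f → IsFullInsurance w f → R (w + f) (w + g)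

/-- Premium calculation principles. -/
def IsPremiumPrinciple (prem : payoffSpace P κ → ℝ) : Prop :=
  ∃ θ : ℝ, 0 < θ ∧ ∀ (h : payoffSpace P κ) (γ : ℝ), prem (h + sure P κ γ) = prem h + θ * γ

/-- Propensity to full insurance at a given price functional. -/
def PropenseToFullInsuranceAt (prem : payoffSpace P κ → ℝ)
    (R : payoffSpace P κ → payoffSpace P κ → Prop) : Prop :=
  ∀ w f g : payoffSpace P κ, EqDist g f → f = -w - sure P κ (prem (-w)) → R (w + f) (w + g)

end

end RiskInsurance

/-! The key fact is `Adequate.exists_coboundary`: a centred payoff `h` has the law of `g - f` for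
some identically distributed `f` and `g`. Insuring the risk `-f`, up to a constant, then compares a
sure amount with a copy of `h` plus that amount. Since `prem` moves by `θ > 0` times the constant,
the constant can be tuned to make the sure amount the mean of any given payoff. The converse only
uses that identically distributed contracts have equal means.

On equally likely cells, `f` lists the partial sums of `h` and `g` is its cyclic shift. On a
nonatomic space, let `μ` be the law of `h`. Draw `x < 0 < y` with weight proportional to `(y - x)
μ(dx) μ(dy)` and `u` uniform on `[0, y - x)`. Rotating by `y` preserves the law of `u` and moves it
by `y` with probability `-x / (y - x)`, otherwise by `x`. The displacement has law `μ` because the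
two signed parts of `μ` have equal mass; an atom at `0` stays put. Nonatomicity realises this triple
on `S`. -/

namespace RiskInsurance

/-! ### Random variables of arbitrary law on a nonatomic space -/

section UniformVariable

open Set Filter Topology

variable {S : Type*} [MeasurableSpace S] {P : Measure S}

/-- A family of measurable sets that is maximal among those totally ordered by almost sure
inclusion. -/
structure IsMaxAEChain (P : Measure S) (C : Set (Set S)) : Prop where
  measurableSet : ∀ A ∈ C, MeasurableSet A
  total : ∀ A ∈ C, ∀ B ∈ C, A ≤ᵐ[P] B ∨ B ≤ᵐ[P] A
  mem_of_comparable : ∀ D, MeasurableSet D → (∀ E ∈ C, D ≤ᵐ[P] E ∨ E ≤ᵐ[P] D) → D ∈ C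

theorem exists_isMaxAEChain (P : Measure S) : ∃ C, IsMaxAEChain P C := by
  let r : {A : Set S // MeasurableSet A} → {A : Set S // MeasurableSet A} → Prop :=
    fun A B => A.1 ≤ᵐ[P] B.1
  have hmax : IsMaxChain r (maxChain r) := maxChain_spec
  refine ⟨Subtype.val '' maxChain r, ?_, ?_, ?_⟩
  · rintro _ ⟨A, -, rfl⟩
    exact A.2
  · rintro _ ⟨A, hA, rfl⟩ _ ⟨B, hB, rfl⟩
    by_cases hAB : A = B
    · exact Or.inl (hAB ▸ EventuallyLE.refl _ _)
    · exact hmax.1 hA hB hAB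
  · intro D hD h
    have hins : IsChain r (insert ⟨D, hD⟩ (maxChain r)) :=
      hmax.1.insert fun E hE _ => h E.1 ⟨E, hE, rfl⟩
    refine ⟨⟨D, hD⟩, ?_, rfl⟩
    rw [hmax.2 hins (subset_insert _ _)]
    exact mem_insert _ _

namespace IsMaxAEChain

variable {C : Set (Set S)}

theorem ae_le_of_measure_le [IsProbabilityMeasure P] (hC : IsMaxAEChain P C) {A B : Set S} (hA : A ∈ C) (hB : B ∈ C)
    (h : P A ≤ P B) : A ≤ᵐ[P] B := by
  rcases hC.total A hA B hB with h' | h'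
  · exact h'
  · exact (ae_eq_of_ae_subset_of_measure_ge h' h (hC.measurableSet B hB).nullMeasurableSet
      (measure_ne_top _ _)).symm.le

theorem iUnion_mem (hC : IsMaxAEChain P C) {B : ℕ → Set S} (hB : ∀ n, B n ∈ C) :
    (⋃ n, B n) ∈ C := by
  refine hC.mem_of_comparable _ (.iUnion fun n => hC.measurableSet _ (hB n)) fun E hE => ?_
  by_cases h : ∀ n, B n ≤ᵐ[P] E
  · left
    filter_upwards [ae_all_iff.2 h] with s hs hsB
    obtain ⟨n, hn⟩ := mem_iUnion.1 hsB
    exact hs n hn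
  · push Not at h
    obtain ⟨n, hn⟩ := h
    right
    exact ((hC.total _ (hB n) _ hE).resolve_left hn).trans
      (subset_iUnion B n).eventuallyLE

/-- Duality that turns `exists_greatest_le` into `exists_least_ge`. -/
theorem compl (hC : IsMaxAEChain P C) : IsMaxAEChain P (Compl.compl ⁻¹' C) where
  measurableSet A hA := (hC.measurableSet _ hA).of_compl
  total A hA B hB := by
    rcases hC.total _ hA _ hB with h | h
    · right
      exact ae_le_set.2 (by simpa [sdiff_eq, inter_comm] using ae_le_set.1 h)
    · left
      exact ae_le_set.2 (by simpa [sdiff_eq, inter_comm] using ae_le_set.1 h)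
  mem_of_comparable D hD h := by
    refine hC.mem_of_comparable _ hD.compl fun E hE => ?_
    rcases h Eᶜ (by simpa using hE) with h | h
    · right
      exact ae_le_set.2 (by simpa [sdiff_eq, inter_comm] using ae_le_set.1 h)
    · left
      exact ae_le_set.2 (by simpa [sdiff_eq, inter_comm] using ae_le_set.1 h)

theorem empty_mem (hC : IsMaxAEChain P C) : ∅ ∈ C :=
  hC.mem_of_comparable _ .empty fun E _ => Or.inl (empty_subset E).eventuallyLE

theorem exists_greatest_le [IsProbabilityMeasure P] (hC : IsMaxAEChain P C) (t : ENNReal) :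
    ∃ B ∈ C, P B ≤ t ∧ ∀ E ∈ C, P E ≤ t → P E ≤ P B := by
  have hne : (P '' {B ∈ C | P B ≤ t}).Nonempty :=
    ⟨P ∅, ∅, ⟨hC.empty_mem, by simp⟩, rfl⟩
  obtain ⟨u, hu, hlim, hmem⟩ := exists_seq_tendsto_sSup hne (OrderTop.bddAbove _)
  choose B hB hBu using hmem
  have hle : ∀ n, P (B n) ≤ t := fun n => (hB n).2
  refine ⟨⋃ n, B n, hC.iUnion_mem fun n => (hB n).1, ?_, fun E hE hEt => ?_⟩
  · refine le_of_tendsto' (tendsto_measure_iUnion_accumulate (μ := P) (f := B)) fun n => ?_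
    refine le_trans (measure_mono_ae ?_) (hle n)
    -- The measures increase along the sequence, so the first `n` sets all lie almost surely in the
    -- `n`-th.
    have : ∀ k, k ≤ n → B k ≤ᵐ[P] B n := fun k hk =>
      hC.ae_le_of_measure_le (hB k).1 (hB n).1 (by rw [hBu, hBu]; exact hu hk)
    have := ae_all_iff.2 fun k => ae_all_iff.2 (this k)
    filter_upwards [this] with s hs hsA
    obtain ⟨k, hk, hsk⟩ := mem_accumulate.1 hsA
    exact hs k hk hsk
  · refine le_trans (le_sSup (mem_image_of_mem P (show E ∈ {B ∈ C | P B ≤ t} from ⟨hE, hEt⟩))) (le_of_tendsto' hlim fun n => ?_)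
    rw [← hBu]
    exact measure_mono (subset_iUnion B n)

theorem exists_least_ge [IsProbabilityMeasure P] (hC : IsMaxAEChain P C) {t : ENNReal} (ht : t ≤ 1) :
    ∃ B ∈ C, t ≤ P B ∧ ∀ E ∈ C, t ≤ P E → P B ≤ P E := by
  obtain ⟨B, hB, hBt, hmax⟩ := hC.compl.exists_greatest_le (1 - t)
  have hm : ∀ A, A ∈ C → P Aᶜ = 1 - P A := fun A hA =>
    prob_compl_eq_one_sub (hC.measurableSet A hA)
  have hB' : P B = 1 - P Bᶜ := by simpa using hm _ hB
  refine ⟨Bᶜ, hB, ?_, fun E hE hEt => ?_⟩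
  · rw [hB'] at hBt
    exact (ENNReal.sub_le_sub_iff_left ht ENNReal.one_ne_top).1 hBt
  · have := hmax Eᶜ (by simpa using hE) (by rw [hm E hE]; exact tsub_le_tsub_left hEt _)
    rw [hm E hE, hB'] at this
    exact (ENNReal.sub_le_sub_iff_left prob_le_one ENNReal.one_ne_top).1 this

/-- If `t` were skipped, the members just below and just above it would differ by a set of positive
measure. A proper part of that gap, added to the lower member, is comparable with the whole chain,
hence belongs to it, contradicting extremality. -/
theorem exists_measure_eq [IsProbabilityMeasure P] (hC : IsMaxAEChain P C) (hP : Nonatomic P)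
    {t : ENNReal} (ht : t ≤ 1) :
    ∃ B ∈ C, P B = t := by
  obtain ⟨B, hB, hBt, hBmax⟩ := hC.exists_greatest_le t
  obtain ⟨A, hA, hAt, hAmin⟩ := hC.exists_least_ge ht
  by_contra! hne
  have hlt : P B < t := lt_of_le_of_ne hBt (hne B hB)
  have hBA : B ≤ᵐ[P] A := hC.ae_le_of_measure_le hB hA (hBt.trans hAt)
  have hBm := hC.measurableSet B hB
  have hAm := hC.measurableSet A hA
  have hadd : P B + P (A \ B) = P A := by
    rw [← measure_union disjoint_sdiff_right (hAm.diff hBm), union_sdiff_self]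
    refine measure_congr (union_comm B A ▸ ?_)
    exact union_ae_eq_left_iff_ae_subset.2 hBA
  have hpos : 0 < P (A \ B) := by
    rw [pos_iff_ne_zero]
    intro h0
    rw [h0, add_zero] at hadd
    exact absurd (hlt.trans_le hAt) (by rw [hadd]; exact lt_irrefl _)
  obtain ⟨D, hDm, hDs, hD0, hD1⟩ := hP _ (hAm.diff hBm) hpos
  have hdisj : Disjoint B D := disjoint_sdiff_right.mono_right hDs
  have hBD : P (B ∪ D) = P B + P D := measure_union hdisj hDm
  have hmem : B ∪ D ∈ C := by
    refine hC.mem_of_comparable _ (hBm.union hDm) fun E hE => ?_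
    rcases le_total (P E) t with h | h
    · right
      exact (hC.ae_le_of_measure_le hE hB (hBmax E hE h)).trans subset_union_left.eventuallyLE
    · left
      refine EventuallyLE.trans ?_ (hC.ae_le_of_measure_le hA hE (hAmin E hE h))
      filter_upwards [hBA] with s hs hsBD
      exact hsBD.elim hs fun h => (hDs h).1
  rcases le_total (P (B ∪ D)) t with h | h
  · have := hBmax _ hmem h
    rw [hBD] at this
    exact absurd this (not_le.2 (ENNReal.lt_add_right (measure_ne_top _ _) hD0.ne'))
  · have := hAmin _ hmem h
    rw [hBD, ← hadd] at this
    exact absurd this (not_le.2 (ENNReal.add_lt_add_left (measure_ne_top _ _) hD1))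

end IsMaxAEChain

variable [IsProbabilityMeasure P]

/-- A nonatomic probability space carries a uniformly distributed random variable. -/
theorem Nonatomic.exists_uniform (hP : Nonatomic P) :
    ∃ U : S → unitInterval, Measurable U ∧ P.map U = volume := by
  obtain ⟨C, hC⟩ := exists_isMaxAEChain P
  have hex : ∀ q : unitInterval, ∃ B ∈ C, P B = ENNReal.ofReal q := fun q =>
    hC.exists_measure_eq hP (ENNReal.ofReal_le_one.2 q.2.2)
  choose B hB hBq using hex
  obtain ⟨D, hDc, hD⟩ := TopologicalSpace.exists_countable_dense unitInterval
  -- The sets `B q` are nested only almost surely; countability of `D` keeps the exceptional set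
  -- null. Points in no `B q` get `sInf ∅ = 1`, which is never below `t`.
  let U : S → unitInterval := fun s => sInf {q ∈ D | s ∈ B q}
  have hU : ∀ t, U ⁻¹' Iio t = ⋃ q ∈ D ∩ Iio t, B q := by
    intro t
    ext s
    simp only [mem_preimage, mem_Iio, U, sInf_lt_iff, mem_iUnion, mem_inter_iff, exists_prop,
      mem_ofPred_eq]
    grind
  have hcount : ∀ t : unitInterval, (D ∩ Iio t).Countable := fun t => hDc.mono inter_subset_left
  have hUm : Measurable U := measurable_of_Iio fun t => by
    rw [hU]
    exact .biUnion (hcount t) fun q _ => hC.measurableSet _ (hB q)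
  have hmeas : ∀ t, P (U ⁻¹' Iio t) = ENNReal.ofReal t := by
    intro t
    rw [hU]
    apply le_antisymm
    · rw [← hBq t]
      refine measure_mono_ae ?_
      have : ∀ q ∈ D ∩ Iio t, B q ≤ᵐ[P] B t := fun q hq =>
        hC.ae_le_of_measure_le (hB q) (hB t) (by
          rw [hBq, hBq]
          exact ENNReal.ofReal_le_ofReal (le_of_lt hq.2))
      filter_upwards [(ae_ball_iff (hcount t)).2 this] with s hs hsB
      obtain ⟨q, hq, hsq⟩ := mem_iUnion₂.1 hsB
      exact hs q hq hsq
    -- Otherwise density gives `q ∈ D` strictly between the measure of the union and `t`, yet `B q`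
    -- is part of the union.
    · by_contra! hlt
      have hlt' := (ENNReal.lt_ofReal_iff_toReal_lt (measure_ne_top _ _)).1 hlt
      obtain ⟨q, hqD, hq0, hqt⟩ := hD.exists_between
        (show (⟨P.real (⋃ q ∈ D ∩ Iio t, B q), measureReal_nonneg, measureReal_le_one⟩ :
          unitInterval) < t from hlt')
      have hle : P (B q) ≤ P (⋃ q ∈ D ∩ Iio t, B q) :=
        measure_mono (subset_biUnion_of_mem (u := B) (show q ∈ D ∩ Iio t from ⟨hqD, hqt⟩))
      rw [hBq, ENNReal.ofReal_le_iff_le_toReal (measure_ne_top _ _)] at hle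
      exact absurd hq0 (not_lt.2 hle)
  refine ⟨U, hUm, ?_⟩
  have := Measure.isProbabilityMeasure_map (μ := P) hUm.aemeasurable
  refine Measure.ext_of_Ici _ _ fun t => ?_
  rw [← compl_Iio, prob_compl_eq_one_sub measurableSet_Iio,
    prob_compl_eq_one_sub measurableSet_Iio, Measure.map_apply hUm measurableSet_Iio, hmeas,
    unitInterval.volume_Iio]

/-- On a nonatomic probability space every Borel law is the law of some random variable. -/
theorem Nonatomic.exists_map_eq (hP : Nonatomic P) {Y : Type*} [MeasurableSpace Y]
    [StandardBorelSpace Y] [Nonempty Y] (ν : Measure Y) [IsProbabilityMeasure ν] :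
    ∃ Z : S → Y, Measurable Z ∧ P.map Z = ν := by
  obtain ⟨U, hU, hUP⟩ := hP.exists_uniform
  obtain ⟨q, hq, hqν⟩ := ν.exists_measurable_map_eq
  exact ⟨q ∘ U, hq.comp hU, by rw [← Measure.map_map hq hU, hUP, hqν]⟩

end UniformVariable

end RiskInsurance

namespace RiskInsurance

/-! ### The rotation coupling of a centred law -/

section Coupling

open Set
open scoped ENNReal

/-- The weight of the negative and positive parts of a law on the half-planes `x < 0 < y`. -/
noncomputable def signPairs (μ : Measure ℝ) : Measure (ℝ × ℝ) :=
  (μ.restrict (Iio 0)).prod (μ.restrict (Ioi 0))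

/-- The mass of the positive part of a law. -/
noncomputable def posMass (μ : Measure ℝ) : ℝ≥0∞ := ∫⁻ y in Ioi 0, ENNReal.ofReal y ∂μ

/-- The mass of the negative part of a law. -/
noncomputable def negMass (μ : Measure ℝ) : ℝ≥0∞ := ∫⁻ x in Iio 0, ENNReal.ofReal (-x) ∂μ

/-- The part of the rotation coupling carried by the points `((x, y), u)` with `x < 0 < y` and
`0 ≤ u < y - x`. -/
noncomputable def rotationMeasure (μ : Measure ℝ) : Measure ((ℝ × ℝ) × ℝ) :=
  ((signPairs μ).prod volume).restrict {z | 0 ≤ z.2 ∧ z.2 < z.1.2 - z.1.1}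

/-- A law of triples `((x, y), u)`: given `x < 0 < y`, the point `u` is uniform on
`[0, y - x)`, and the rotation by `y` of that interval moves it by `y` or by `x`. -/
noncomputable def rotationCoupling (μ : Measure ℝ) : Measure ((ℝ × ℝ) × ℝ) :=
  (posMass μ)⁻¹ • rotationMeasure μ + μ {0} • Measure.dirac 0

/-- The displacement of `u` under the rotation by `y` of `[0, y - x)`. -/
noncomputable def displacement (z : (ℝ × ℝ) × ℝ) : ℝ := if z.2 < -z.1.1 then z.1.2 else z.1.1

@[fun_prop]
theorem measurable_displacement : Measurable displacement :=
  Measurable.ite (measurableSet_lt measurable_snd (by fun_prop)) (by fun_prop) (by fun_prop)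

variable {μ : Measure ℝ} [IsProbabilityMeasure μ]

instance : IsFiniteMeasure (signPairs μ) := by unfold signPairs; infer_instance

theorem measurableSet_rotationDomain :
    MeasurableSet {z : (ℝ × ℝ) × ℝ | 0 ≤ z.2 ∧ z.2 < z.1.2 - z.1.1} :=
  (measurableSet_le (f := fun _ : (ℝ × ℝ) × ℝ => (0 : ℝ)) (g := fun z => z.2) (by fun_prop)
    (by fun_prop)).inter (measurableSet_lt (f := fun z : (ℝ × ℝ) × ℝ => z.2)
      (g := fun z => z.1.2 - z.1.1) (by fun_prop) (by fun_prop))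

omit [IsProbabilityMeasure μ] in
theorem lintegral_rotationMeasure {F : (ℝ × ℝ) × ℝ → ℝ≥0∞} (hF : Measurable F) :
    ∫⁻ z, F z ∂(rotationMeasure μ) =
      ∫⁻ p, (∫⁻ u in Ico 0 (p.2 - p.1), F (p, u)) ∂(signPairs μ) := by
  have hT := measurableSet_rotationDomain
  rw [rotationMeasure, ← lintegral_indicator hT, lintegral_prod _ (hF.indicator hT).aemeasurable]
  refine lintegral_congr fun p => ?_
  rw [← lintegral_indicator measurableSet_Ico]
  rfl

theorem ae_signPairs : ∀ᵐ p ∂(signPairs μ), p.1 < 0 ∧ 0 < p.2 := by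
  have h : signPairs μ = (μ.prod μ).restrict (Iio 0 ×ˢ Ioi 0) := by
    rw [signPairs, Measure.prod_restrict]
  rw [h]
  filter_upwards [ae_restrict_mem (measurableSet_Iio.prod measurableSet_Ioi)] with p hp
  exact hp

theorem setLIntegral_Ico_add (φ : ℝ → ℝ≥0∞) (a b c : ℝ) :
    ∫⁻ u in Ico a b, φ (u + c) = ∫⁻ u in Ico (a + c) (b + c), φ u := by
  rw [← lintegral_indicator measurableSet_Ico, ← lintegral_indicator measurableSet_Ico,
    ← lintegral_add_right_eq_self ((Ico (a + c) (b + c)).indicator _) c]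
  refine lintegral_congr fun u => ?_
  simp [indicator]

theorem setLIntegral_Ico_split (φ : ℝ → ℝ≥0∞) {a b c : ℝ} (hab : a ≤ b) (hbc : b ≤ c) :
    ∫⁻ u in Ico a c, φ u = (∫⁻ u in Ico a b, φ u) + ∫⁻ u in Ico b c, φ u := by
  rw [← Ico_union_Ico_eq_Ico hab hbc, lintegral_union measurableSet_Ico]
  exact Ico_disjoint_Ico_same

theorem setLIntegral_displacement (φ : ℝ → ℝ → ℝ≥0∞) {x y : ℝ} (hx : x < 0) (hy : 0 < y) :
    ∫⁻ u in Ico 0 (y - x), φ u (displacement ((x, y), u)) =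
      (∫⁻ u in Ico 0 (-x), φ u y) + ∫⁻ u in Ico (-x) (y - x), φ u x := by
  rw [setLIntegral_Ico_split _ (show (0 : ℝ) ≤ -x by linarith) (show -x ≤ y - x by linarith)]
  congr 1
  · exact setLIntegral_congr_fun measurableSet_Ico fun u hu => by simp [displacement, hu.2]
  · exact setLIntegral_congr_fun measurableSet_Ico fun u hu => by
      simp [displacement, not_lt.2 hu.1]

/-- The rotation exchanges two blocks: `[0, -x)` goes to `[y, y - x)` and `[-x, y - x)` to `[0, y)`.
-/
theorem lintegral_rotation (φ : ℝ → ℝ≥0∞) {x y : ℝ} (hx : x < 0) (hy : 0 < y) :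
    ∫⁻ u in Ico 0 (y - x), φ (u + displacement ((x, y), u)) = ∫⁻ u in Ico 0 (y - x), φ u := by
  rw [setLIntegral_displacement (fun u d => φ (u + d)) hx hy, setLIntegral_Ico_add,
    setLIntegral_Ico_add, setLIntegral_Ico_split φ hy.le (show y ≤ y - x by linarith), add_comm]
  congr 3 <;> ring_nf

theorem map_rotation_eq :
    (rotationCoupling μ).map (fun z => z.2 + displacement z) = (rotationCoupling μ).map Prod.snd := by
  refine Measure.ext_of_lintegral _ fun φ hφ => ?_
  rw [lintegral_map hφ (by fun_prop), lintegral_map hφ (by fun_prop)]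
  simp only [rotationCoupling, lintegral_add_measure, lintegral_smul_measure]
  rw [lintegral_rotationMeasure (by fun_prop), lintegral_rotationMeasure (by fun_prop)]
  congr 2
  · refine lintegral_congr_ae ?_
    filter_upwards [ae_signPairs] with p hp
    exact lintegral_rotation φ hp.1 hp.2
  · rw [lintegral_dirac' _ (by fun_prop), lintegral_dirac' _ (by fun_prop)]
    simp [displacement]

/-- The block moved by `y` has length `-x` and the block moved by `x` has length `y`, so each sign
is weighted by the mass of the other. -/
theorem lintegral_rotationMeasure_displacement {φ : ℝ → ℝ≥0∞} (hφ : Measurable φ) :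
    ∫⁻ z, φ (displacement z) ∂(rotationMeasure μ) =
      negMass μ * (∫⁻ y in Ioi 0, φ y ∂μ) + (∫⁻ x in Iio 0, φ x ∂μ) * posMass μ := by
  rw [lintegral_rotationMeasure (by fun_prop)]
  have h : ∀ᵐ p ∂(signPairs μ), ∫⁻ u in Ico 0 (p.2 - p.1), φ (displacement (p, u)) =
      ENNReal.ofReal (-p.1) * φ p.2 + φ p.1 * ENNReal.ofReal p.2 := by
    filter_upwards [ae_signPairs] with p hp
    rw [setLIntegral_displacement (fun _ d => φ d) hp.1 hp.2]
    simp [mul_comm]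
  rw [lintegral_congr_ae h, lintegral_add_left (by fun_prop), signPairs,
    lintegral_prod_mul (f := fun x => ENNReal.ofReal (-x)) (by fun_prop) (by fun_prop),
    lintegral_prod_mul (g := fun x => ENNReal.ofReal x) (by fun_prop) (by fun_prop)]
  rfl

omit [IsProbabilityMeasure μ] in
theorem negMass_eq_posMass (hμ : Integrable id μ) (h0 : ∫ x, x ∂μ = 0) : negMass μ = posMass μ := by
  have h1 : posMass μ = ∫⁻ y, ENNReal.ofReal y ∂μ := by
    rw [posMass, ← lintegral_indicator measurableSet_Ioi]
    refine lintegral_congr fun y => ?_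
    by_cases hy : 0 < y
    · simp [hy]
    · simp [hy, ENNReal.ofReal_of_nonpos (not_lt.1 hy)]
  have h2 : negMass μ = ∫⁻ y, ENNReal.ofReal (-y) ∂μ := by
    rw [negMass, ← lintegral_indicator measurableSet_Iio]
    refine lintegral_congr fun y => ?_
    by_cases hy : y < 0
    · simp [hy]
    · simp [hy, ENNReal.ofReal_of_nonpos (neg_nonpos.2 (not_lt.1 hy))]
  have h3 := integral_eq_lintegral_pos_part_sub_lintegral_neg_part hμ
  simp only [id] at h3
  rw [h0, ← h1, ← h2, eq_comm, sub_eq_zero, ENNReal.toReal_eq_toReal_iff'] at h3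
  · exact h3.symm
  · rw [h1]; exact hμ.lintegral_lt_top.ne
  · rw [h2]; exact hμ.neg.lintegral_lt_top.ne

omit [IsProbabilityMeasure μ] in
theorem posMass_ne_top (hμ : Integrable id μ) : posMass μ ≠ ∞ :=
  ((setLIntegral_le_lintegral _ _).trans_lt hμ.lintegral_lt_top).ne

omit [IsProbabilityMeasure μ] in
theorem lintegral_eq_sign_split (φ : ℝ → ℝ≥0∞) (hφ : Measurable φ) :
    ∫⁻ x, φ x ∂μ = (∫⁻ y in Ioi 0, φ y ∂μ) + (∫⁻ x in Iio 0, φ x ∂μ) + μ {0} * φ 0 := by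
  rw [← lintegral_add_compl φ (measurableSet_Ioi (a := (0 : ℝ))), compl_Ioi, ← Iio_union_right,
    lintegral_union (measurableSet_singleton 0) (by simp), add_assoc, lintegral_singleton' hφ,
    mul_comm]

theorem map_displacement_eq (hμ : Integrable id μ) (h0 : ∫ x, x ∂μ = 0) (hc : posMass μ ≠ 0) :
    (rotationCoupling μ).map displacement = μ := by
  refine Measure.ext_of_lintegral _ fun φ hφ => ?_
  rw [lintegral_map hφ (by fun_prop), lintegral_eq_sign_split φ hφ]
  simp only [rotationCoupling, lintegral_add_measure, lintegral_smul_measure]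
  rw [lintegral_rotationMeasure_displacement hφ, negMass_eq_posMass hμ h0,
    mul_comm _ (posMass μ), ← mul_add, smul_eq_mul, ← mul_assoc,
    ENNReal.inv_mul_cancel hc (posMass_ne_top hμ), one_mul, lintegral_dirac' _ (by fun_prop)]
  simp [displacement]

/-- The total mass is read off from the image under `displacement`. -/
theorem isProbabilityMeasure_rotationCoupling (hμ : Integrable id μ) (h0 : ∫ x, x ∂μ = 0)
    (hc : posMass μ ≠ 0) : IsProbabilityMeasure (rotationCoupling μ) := by
  have h : IsProbabilityMeasure ((rotationCoupling μ).map displacement) := by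
    rw [map_displacement_eq hμ h0 hc]; infer_instance
  exact (Measure.isProbabilityMeasure_map_iff measurable_displacement.aemeasurable).1 h

omit [IsProbabilityMeasure μ] in
theorem ae_eq_zero_of_posMass (hμ : Integrable id μ) (h0 : ∫ x, x ∂μ = 0) (hc : posMass μ = 0) :
    ∀ᵐ x ∂μ, x = 0 := by
  have hn : negMass μ = 0 := (negMass_eq_posMass hμ h0).trans hc
  rw [posMass, lintegral_eq_zero_iff (by fun_prop), Filter.EventuallyEq,
    ae_restrict_iff' measurableSet_Ioi] at hc
  rw [negMass, lintegral_eq_zero_iff (by fun_prop), Filter.EventuallyEq,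
    ae_restrict_iff' measurableSet_Iio] at hn
  filter_upwards [hc, hn] with x h1 h2
  simp only [mem_Ioi, mem_Iio, Pi.zero_apply, ENNReal.ofReal_eq_zero] at h1 h2
  grind

theorem memLp_signPairs {p : ℝ≥0∞} (hp : MemLp id p μ) :
    MemLp (fun q : ℝ × ℝ => q.2 - q.1) p (signPairs μ) := by
  have h2 : MemLp (fun q : ℝ × ℝ => q.2) p (signPairs μ) := (hp.restrict (Ioi 0)).comp_snd _
  have h1 : MemLp (fun q : ℝ × ℝ => q.1) p (signPairs μ) := (hp.restrict (Iio 0)).comp_fst _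
  exact h2.sub h1

theorem memLp_top_rotation (hp : MemLp id ⊤ μ) :
    MemLp Prod.snd ⊤ (rotationCoupling μ) := by
  have hB := (memLp_signPairs hp).2.ne
  set B := eLpNorm (fun q : ℝ × ℝ => q.2 - q.1) ⊤ (signPairs μ)
  have hae : ∀ᵐ q ∂(signPairs μ), ‖q.2 - q.1‖ₑ ≤ B := ae_le_eLpNormEssSup
  refine memLp_top_of_bound_enorm (by fun_prop) B.toNNReal ?_
  rw [ENNReal.coe_toNNReal hB, rotationCoupling, ae_add_measure_iff]
  constructor
  · refine Measure.ae_smul_measure ?_ _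
    rw [rotationMeasure, ae_restrict_iff' measurableSet_rotationDomain]
    filter_upwards [Measure.quasiMeasurePreserving_fst.ae hae] with z hz hzT
    refine le_trans ?_ hz
    rw [Real.enorm_eq_ofReal hzT.1, Real.enorm_eq_ofReal (hzT.1.trans hzT.2.le)]
    exact ENNReal.ofReal_le_ofReal hzT.2.le
  · refine Measure.ae_smul_measure ?_ _
    rw [ae_dirac_eq]
    simp

/-- One moment is lost: `u ^ n` is at most `(y - x) ^ n` on an interval of length `y - x`. This is
harmless when all moments are finite. -/
theorem memLp_nat_rotation (hc : posMass μ ≠ 0) (n : ℕ) (hp : MemLp id ((n + 1 : ℕ) : ℝ≥0∞) μ) :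
    MemLp Prod.snd (n : ℝ≥0∞) (rotationCoupling μ) := by
  rcases Nat.eq_zero_or_pos n with rfl | hn
  · simp only [Nat.cast_zero, memLp_zero_iff_aestronglyMeasurable]
    fun_prop
  have hn0 : (n : ℝ≥0∞) ≠ 0 := by exact_mod_cast hn.ne'
  refine ⟨by fun_prop, ?_⟩
  rw [eLpNorm_lt_top_iff_lintegral_rpow_enorm_lt_top hn0 (ENNReal.natCast_ne_top n)]
  simp only [rotationCoupling, lintegral_add_measure, lintegral_smul_measure,
    ENNReal.toReal_natCast, ENNReal.rpow_natCast, smul_eq_mul]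
  rw [lintegral_rotationMeasure (by fun_prop), lintegral_dirac' _ (by fun_prop)]
  have hfin := (eLpNorm_lt_top_iff_lintegral_rpow_enorm_lt_top
    (by exact_mod_cast n.succ_ne_zero) (ENNReal.natCast_ne_top (n + 1))).1 (memLp_signPairs hp).2
  simp only [ENNReal.toReal_natCast, ENNReal.rpow_natCast] at hfin
  have hle : ∫⁻ q, (∫⁻ u in Ico 0 (q.2 - q.1), ‖u‖ₑ ^ n) ∂(signPairs μ) ≤
      ∫⁻ q, ‖q.2 - q.1‖ₑ ^ (n + 1) ∂(signPairs μ) := by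
    refine lintegral_mono_ae ?_
    filter_upwards [ae_signPairs] with q hq
    have hq0 : 0 ≤ q.2 - q.1 := by linarith [hq.1, hq.2]
    calc ∫⁻ u in Ico 0 (q.2 - q.1), ‖u‖ₑ ^ n
        ≤ ∫⁻ _ in Ico 0 (q.2 - q.1), ‖q.2 - q.1‖ₑ ^ n := by
          refine setLIntegral_mono measurable_const fun u hu => ?_
          rw [Real.enorm_eq_ofReal hu.1, Real.enorm_eq_ofReal hq0]
          exact pow_le_pow_left' (ENNReal.ofReal_le_ofReal hu.2.le) n
      _ = ‖q.2 - q.1‖ₑ ^ (n + 1) := by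
          rw [setLIntegral_const, Real.volume_Ico, sub_zero, pow_succ, Real.enorm_eq_ofReal hq0]
  refine ENNReal.add_lt_top.2 ⟨ENNReal.mul_lt_top (ENNReal.inv_lt_top.2 (pos_iff_ne_zero.2 hc))
    (hle.trans_lt hfin), ENNReal.mul_lt_top (measure_lt_top _ _) ?_⟩
  simp [hn.ne']

end Coupling

end RiskInsurance

namespace RiskInsurance

/-! ### Centred payoffs as differences of identically distributed payoffs -/

section Coboundary

variable {S : Type*} [MeasurableSpace S] {P : Measure S} [IsProbabilityMeasure P]
  {κ : PayoffClass}

omit [IsProbabilityMeasure P] in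
theorem measurable_payoff (f : payoffSpace P κ) : Measurable (f : S → ℝ) := by
  cases κ <;> exact f.2.1

theorem integrable_payoff (f : payoffSpace P κ) : Integrable (f : S → ℝ) P := by
  cases κ
  · exact f.2.2.integrable le_top
  · exact memLp_one_iff_integrable.1 (by simpa using f.2.2 1)

theorem mem_payoffSpace_of_memLp_top {f : S → ℝ} (hf : Measurable f) (h : MemLp f ⊤ P) :
    f ∈ payoffSpace P κ := by
  cases κ
  · exact ⟨hf, h⟩
  · exact ⟨hf, fun p => h.mono_exponent le_top⟩

omit [IsProbabilityMeasure P] in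
-- Spares any integrability estimate for the rotated payoff.
theorem mem_payoffSpace_of_map_eq {f : S → ℝ} (hf : Measurable f) (g : payoffSpace P κ)
    (h : P.map f = P.map (g : S → ℝ)) : f ∈ payoffSpace P κ := by
  have key : ∀ p : ENNReal, MemLp (g : S → ℝ) p P → MemLp f p P := fun p hp =>
    (memLp_map_measure_iff (g := id) (by fun_prop) hf.aemeasurable).1 (h ▸
      (memLp_map_measure_iff (g := id) (by fun_prop) (measurable_payoff g).aemeasurable).2 hp)
  cases κ
  · exact ⟨hf, key _ g.2.2⟩
  · exact ⟨hf, fun p => key _ (g.2.2 p)⟩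

theorem exists_coboundary_of_nonatomic (hP : Nonatomic P) (h : payoffSpace P κ)
    (h0 : expect h = 0) : ∃ f g : payoffSpace P κ, EqDist g f ∧ EqDist (g - f) h := by
  have hm := measurable_payoff h
  let μ := P.map (h : S → ℝ)
  have : IsProbabilityMeasure μ := Measure.isProbabilityMeasure_map hm.aemeasurable
  have hμ : Integrable id μ :=
    (integrable_map_measure (by fun_prop) hm.aemeasurable).2 (integrable_payoff h)
  have hμ0 : ∫ x, x ∂μ = 0 := by
    rw [integral_map hm.aemeasurable (by fun_prop)]
    exact h0
  -- Here the normalising constant `(posMass μ)⁻¹` degenerates, but the payoff vanishes almost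
  -- surely.
  by_cases hc : posMass μ = 0
  · refine ⟨0, 0, rfl, ?_⟩
    have := ae_of_ae_map hm.aemeasurable (ae_eq_zero_of_posMass hμ hμ0 hc)
    refine Measure.map_congr ?_
    filter_upwards [this] with s hs
    simp [hs]
  · have := isProbabilityMeasure_rotationCoupling hμ hμ0 hc
    obtain ⟨Z, hZ, hZP⟩ := hP.exists_map_eq (rotationCoupling μ)
    have hLp : ∀ p : ENNReal, MemLp Prod.snd p (rotationCoupling μ) →
        MemLp (fun s => (Z s).2) p P := fun p hp =>
      (memLp_map_measure_iff (g := Prod.snd) (by fun_prop) hZ.aemeasurable).1 (hZP ▸ hp)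
    have hμLp : ∀ p : ENNReal, MemLp (h : S → ℝ) p P → MemLp id p μ := fun p hp =>
      (memLp_map_measure_iff (g := id) (by fun_prop) hm.aemeasurable).2 hp
    have hfm : Measurable fun s => (Z s).2 := by fun_prop
    have hf : (fun s => (Z s).2) ∈ payoffSpace P κ := by
      clear_value μ
      cases κ
      · exact ⟨hfm, hLp _ (memLp_top_rotation (hμLp _ h.2.2))⟩
      · exact ⟨hfm, fun n => hLp _ (memLp_nat_rotation hc n (hμLp _ (h.2.2 (n + 1))))⟩
    have hgm : Measurable fun s => (Z s).2 + displacement (Z s) := by fun_prop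
    have hlaw : P.map (fun s => (Z s).2 + displacement (Z s)) = P.map fun s => (Z s).2 := by
      have := map_rotation_eq (μ := μ)
      rw [← hZP, Measure.map_map (by fun_prop) hZ, Measure.map_map (by fun_prop) hZ] at this
      exact this
    refine ⟨⟨_, hf⟩, ⟨_, mem_payoffSpace_of_map_eq hgm ⟨_, hf⟩ hlaw⟩, hlaw, ?_⟩
    have hd := map_displacement_eq hμ hμ0 hc
    rw [← hZP, Measure.map_map (by fun_prop) hZ] at hd
    refine Eq.trans ?_ hd
    congr 1
    ext s
    simp

/-- A uniform finite partition is the partition into fibres of a uniformly distributed index, and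
every measurable function factors through that index. -/
theorem UniformOnFinitePartition.exists_index (hP : UniformOnFinitePartition P) :
    ∃ (n : ℕ) (X : S → Fin (n + 1)), Measurable X ∧
      (∀ i, P (X ⁻¹' {i}) = ((n + 1 : ℕ) : ENNReal)⁻¹) ∧
      ∀ h : S → ℝ, Measurable h → ∃ x : Fin (n + 1) → ℝ, h = x ∘ X := by
  obtain ⟨C, hC, hgen, hunif⟩ := hP
  have hne : C.card ≠ 0 := by
    obtain ⟨s⟩ : Nonempty S := P.nonempty_of_neZero
    obtain ⟨A, ⟨hA, -⟩, -⟩ := hC.2 s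
    exact Finset.card_ne_zero_of_mem hA
  obtain ⟨n, hn⟩ := Nat.exists_eq_succ_of_ne_zero hne
  let e : C ≃ Fin (n + 1) := C.equivFinOfCardEq hn
  choose cell hcell huniq using fun s => hC.2 s
  have hcm : ∀ s, cell s ∈ C := fun s => (hcell s).1
  have hfib : ∀ i, (fun s => e ⟨cell s, hcm s⟩) ⁻¹' {i} = (e.symm i : Set S) := by
    intro i
    ext s
    rw [Set.mem_preimage, Set.mem_singleton_iff, ← Equiv.eq_symm_apply]
    constructor
    · intro h
      rw [← h]
      exact (hcell s).2
    · intro h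
      exact Subtype.ext (huniq s _ ⟨(e.symm i).2, h⟩).symm
  have hsep : ∀ A, MeasurableSet A → ∀ s t, cell s = cell t → s ∈ A → t ∈ A := by
    intro A hA
    rw [hgen] at hA
    -- The equivalence, unlike the implication, passes directly through complements in the
    -- induction.
    have : ∀ s t, cell s = cell t → (s ∈ A ↔ t ∈ A) := by
      induction A, hA using MeasurableSpace.generateFrom_induction with
      | hC A hA _ =>
        intro s t hst
        have hmem : ∀ s, s ∈ A ↔ A = cell s := fun s =>
          ⟨fun h => huniq s A ⟨hA, h⟩, fun h => h ▸ (hcell s).2⟩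
        rw [hmem, hmem, hst]
      | empty => simp
      | compl A _ ih => intro s t hst; simp [ih s t hst]
      | iUnion A _ ih => intro s t hst; simp [fun n => ih n s t hst]
    exact fun s t hst => (this s t hst).1
  refine ⟨n, fun s => e ⟨cell s, hcm s⟩, ?_, ?_, ?_⟩
  · refine measurable_to_countable' fun i => ?_
    rw [hfib, hgen]
    exact MeasurableSpace.measurableSet_generateFrom (e.symm i).2
  · intro i
    rw [hfib, hunif _ (e.symm i).2, hn]
  · intro h hh
    have hnonempty : ∀ i, ((e.symm i : C) : Set S).Nonempty := fun i =>
      Set.nonempty_iff_ne_empty.2 fun h0 => hC.1 (h0 ▸ (e.symm i).2)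
    choose r hr using hnonempty
    refine ⟨fun i => h (r i), funext fun s => ?_⟩
    have hrs : cell s = cell (r (e ⟨cell s, hcm s⟩)) := by
      refine huniq _ _ ⟨hcm s, ?_⟩
      have := hr (e ⟨cell s, hcm s⟩)
      rwa [Equiv.symm_apply_apply] at this
    exact (hsep (h ⁻¹' {h s}) (hh (measurableSet_singleton _)) _ _ hrs rfl).symm

theorem exists_coboundary_of_uniform (hP : UniformOnFinitePartition P) (h : payoffSpace P κ)
    (h0 : expect h = 0) : ∃ f g : payoffSpace P κ, EqDist g f ∧ EqDist (g - f) h := by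
  obtain ⟨n, X, hX, hunif, hfac⟩ := hP.exists_index
  obtain ⟨x, hx⟩ := hfac h (measurable_payoff h)
  have hsum : ∑ i, x i = 0 := by
    have : IsFiniteMeasure (P.map X) := Measure.isFiniteMeasure_map P X
    have hE : expect h = ∑ i, ((n + 1 : ℕ) : ℝ)⁻¹ * x i := by
      rw [expect, hx]
      change ∫ s, x (X s) ∂P = _
      rw [← integral_map hX.aemeasurable (by fun_prop), integral_fintype .of_finite]
      refine Finset.sum_congr rfl fun i _ => ?_
      rw [measureReal_def, Measure.map_apply hX (measurableSet_singleton i), hunif]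
      rw [ENNReal.toReal_inv, ENNReal.toReal_natCast, smul_eq_mul]
    rw [h0, ← Finset.mul_sum, eq_comm, mul_eq_zero] at hE
    exact hE.resolve_left (inv_ne_zero (by positivity))
  have hmem : ∀ y : Fin (n + 1) → ℝ, (fun s => y (X s)) ∈ payoffSpace P κ := fun y =>
    mem_payoffSpace_of_memLp_top (Measurable.of_discrete.comp hX)
      (memLp_top_of_bound (Measurable.of_discrete.comp hX).aestronglyMeasurable (∑ i, ‖y i‖)
        (.of_forall fun s => Finset.single_le_sum (f := fun i => ‖y i‖)
          (fun i _ => norm_nonneg _) (Finset.mem_univ (X s))))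
  let x' : ℕ → ℝ := fun k => if hk : k < n + 1 then x ⟨k, hk⟩ else 0
  have hx' : ∀ i : Fin (n + 1), x' i = x i := fun i => dif_pos i.2
  let F : Fin (n + 1) → ℝ := fun i => ∑ k ∈ Finset.range i, x' k
  have hF : ∀ i, F (finRotate (n + 1) i) - F i = x i := by
    intro i
    have hstep : F i + x i = ∑ k ∈ Finset.range (i + 1), x' k := by
      rw [Finset.sum_range_succ, hx']
    rw [sub_eq_iff_eq_add, add_comm (x i), hstep]
    -- At the last index the shift wraps around to the empty sum, which equals the full sum because
    -- the mean is zero.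
    rcases eq_or_ne i (Fin.last n) with rfl | hi
    · rw [finRotate_last, Fin.val_last, Finset.sum_range]
      simp only [hx', hsum]
      simp [F]
    · simp only [F]
      rw [coe_finRotate_of_ne_last hi]
  have hXr : Measurable fun s => finRotate (n + 1) (X s) :=
    (Measurable.of_discrete (f := finRotate (n + 1))).comp hX
  have hrot : P.map (fun s => finRotate (n + 1) (X s)) = P.map X := by
    refine Measure.ext_of_singleton fun i => ?_
    rw [Measure.map_apply hXr (measurableSet_singleton i),
      Measure.map_apply hX (measurableSet_singleton i), hunif,
      ← hunif ((finRotate (n + 1)).symm i)]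
    congr 1
    ext s
    exact ((finRotate (n + 1)).eq_symm_apply).symm
  refine ⟨⟨_, hmem F⟩, ⟨_, hmem (F ∘ finRotate (n + 1))⟩, ?_, ?_⟩
  · change P.map (F ∘ fun s => finRotate (n + 1) (X s)) = P.map (F ∘ X)
    rw [← Measure.map_map .of_discrete hXr, hrot,
      Measure.map_map .of_discrete hX]
  · have : (⟨_, hmem (F ∘ finRotate (n + 1))⟩ - ⟨_, hmem F⟩ : payoffSpace P κ) = h := by
      ext s
      rw [hx]
      exact hF (X s)
    rw [this]
    rfl

/-- On an adequate space every centred payoff has the law of a difference of two payoffs with the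
same law. -/
theorem Adequate.exists_coboundary (hP : Adequate P) (h : payoffSpace P κ)
    (h0 : expect h = 0) : ∃ f g : payoffSpace P κ, EqDist g f ∧ EqDist (g - f) h :=
  hP.elim (fun hP => exists_coboundary_of_nonatomic hP h h0)
    fun hP => exists_coboundary_of_uniform hP h h0

/-! ### Weak risk aversion and full insurance -/

theorem sure_add (a b : ℝ) : sure P κ (a + b) = sure P κ a + sure P κ b := rfl

theorem sure_neg (a : ℝ) : sure P κ (-a) = -sure P κ a := rfl

theorem expect_sure (c : ℝ) : expect (sure P κ c) = c := by simp [expect, sure]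

theorem expect_add (f g : payoffSpace P κ) : expect (f + g) = expect f + expect g :=
  integral_add (integrable_payoff f) (integrable_payoff g)

omit [IsProbabilityMeasure P] in
theorem expect_neg (f : payoffSpace P κ) : expect (-f) = -expect f :=
  integral_neg _

omit [IsProbabilityMeasure P] in
theorem EqDist.expect_eq {f g : payoffSpace P κ} (h : EqDist f g) : expect f = expect g := by
  have key : ∀ f : payoffSpace P κ, expect f = ∫ x, x ∂(P.map (f : S → ℝ)) := fun f =>
    (integral_map (f := fun x => x) (measurable_payoff f).aemeasurable (by fun_prop)).symm
  rw [key, key, h]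

theorem EqDist.add_sure {f g : payoffSpace P κ} (h : EqDist f g) (c : ℝ) :
    EqDist (f + sure P κ c) (g + sure P κ c) := by
  have key : ∀ f : payoffSpace P κ, P.map ((f + sure P κ c : payoffSpace P κ) : S → ℝ) =
      (P.map (f : S → ℝ)).map (· + c) := fun f => by
    rw [Measure.map_map (by fun_prop) (measurable_payoff f)]
    rfl
  rw [EqDist, key, key, h]

variable {R : payoffSpace P κ → payoffSpace P κ → Prop}

/-- The insured position is constant, and that constant is the mean of the position with `g`. -/
theorem WeaklyRiskAverse.propenseToFullInsurance (h : WeaklyRiskAverse R) :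
    PropenseToFullInsurance R := by
  rintro w f g hfg ⟨c, rfl⟩
  have hE : expect (w + g) = -c := by
    rw [expect_add, hfg.expect_eq, sub_eq_add_neg, expect_add, expect_neg, ← sure_neg,
      expect_sure]
    ring
  have hw : w + (-w - sure P κ c) = sure P κ (-c) := by
    rw [sure_neg]; abel
  rw [hw, ← hE]
  exact h _

theorem PropenseToFullInsuranceAt.weaklyRiskAverse (hP : Adequate P)
    {prem : payoffSpace P κ → ℝ} (hprem : IsPremiumPrinciple prem) (hR : IsRiskPreference R)
    (h : PropenseToFullInsuranceAt prem R) : WeaklyRiskAverse R := by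
  intro k
  obtain ⟨θ, hθ, hprem⟩ := hprem
  set m := expect k with hm
  obtain ⟨f, g, hgf, hd⟩ := hP.exists_coboundary (k + sure P κ (-m)) (by
    rw [expect_add, expect_sure, ← hm, add_neg_cancel])
  -- Solves `prem (f + γ) = -m`, so full insurance of `-f - γ` at price `prem` leaves exactly `m`.
  let γ := -(m + prem f) / θ
  have hpr : prem (f + sure P κ γ) = -m := by
    rw [hprem, mul_div_cancel₀ _ hθ.ne']
    ring
  let δ := γ + m
  have hw : -(-f - sure P κ γ) = f + sure P κ γ := by abel
  have key := h (-f - sure P κ γ) (f + sure P κ δ) (g + sure P κ δ) (hgf.add_sure δ) (by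
    rw [hw, hpr, sure_neg, sure_add]; abel)
  have h1 : -f - sure P κ γ + (f + sure P κ δ) = sure P κ m := by
    rw [sure_add]; abel
  have h2 : -f - sure P κ γ + (g + sure P κ δ) = g - f + sure P κ m := by
    rw [sure_add]; abel
  rw [h1, h2] at key
  have h3 := hd.add_sure m
  have h4 : k + sure P κ (-m) + sure P κ m = k := by rw [sure_neg]; abel
  rw [h4] at h3
  exact hR.trans _ _ _ key (hR.lawInvariant _ _ h3).1

end Coboundary

end RiskInsurance

theorem mainTheorem11 {S : Type*} [MeasurableSpace S]
    (P : MeasureTheory.Measure S) [MeasureTheory.IsProbabilityMeasure P]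
    (hP : RiskInsurance.Adequate P)
    (κ : RiskInsurance.PayoffClass)
    (prem : RiskInsurance.payoffSpace P κ → ℝ)
    (hprem : RiskInsurance.IsPremiumPrinciple prem)
    (R : RiskInsurance.payoffSpace P κ → RiskInsurance.payoffSpace P κ → Prop)
    (hR : RiskInsurance.IsRiskPreference R) :
    (RiskInsurance.WeaklyRiskAverse R ↔ RiskInsurance.PropenseToFullInsurance R) ∧
    (RiskInsurance.PropenseToFullInsurance R ↔
      RiskInsurance.PropenseToFullInsuranceAt prem R) := by
  have h12 := RiskInsurance.WeaklyRiskAverse.propenseToFullInsurance (R := R)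
  have h23 : RiskInsurance.PropenseToFullInsurance R →
      RiskInsurance.PropenseToFullInsuranceAt prem R := fun h w f g hgf hf => h w f g hgf ⟨_, hf⟩
  have h31 := fun h : RiskInsurance.PropenseToFullInsuranceAt prem R =>
    h.weaklyRiskAverse hP hprem hR
  exact ⟨⟨h12, fun h => h31 (h23 h)⟩, h23, fun h => h12 (h31 h)⟩
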